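/- Let $M$ be a smooth manifold with a Riemannian metric $\hat g$ and a hypercomplex structure $I_1,I_2,I_3$ (integrable complex structures with $I_1^2=I_2^2=I_3^2=-\mathrm{id}$, $I_1I_2=I_3=-I_2I_1$), with $\hat g(I_rX,I_rY)=\hat g(X,Y)$ for $r=1,2,3$. Suppose that $(M,\hat g,I_1,I_2,I_3)$ is an HKT-space: it carries an HKT-connection $D$, i.e. a linear connection with $D\hat g=0$, $DI_1=DI_2=DI_3=0$, whose torsion $T^D$ is such that $c(X,Y,Z)=\hat g(T^D(X,Y),Z)$ is a $3$-form. Conventions: $\hat F_r(X,Y)=\hat g(I_rX,Y)$; for a $k$-form $\omega$, $(I_r\omega)(X_1,\dots,X_k)=(-1)^k\omega(I_rX_1,\dots,I_rX_k)$ and $d_r\omega=(-1)^kI_r\,d\,I_r\omega$; $\epsilon^{rst}$ is the totally antisymmetric symbol with $\epsilon^{123}=1$. Let $V$ be a smooth vector field which generates a $D(2,1;-1)$-symmetry, that is, $$\mathcal L_V\hat g=0,\qquad \mathcal L_{I_rV}\hat g=0,\qquad \mathcal L_{I_rV}I_s=\sum_t\epsilon^{rst}I_t\qquad(r,s\in\{1,2,3\}),$$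 and the dual $1$-form $\hat\theta=\hat g(V,\cdot)$ is closed. Then $\omega=-2\hat\theta$ is a potential $1$-form: with $\omega_r=I_r\omega$, $$\hat F_1=\tfrac12(d\omega_1+d_2\omega_3),\qquad \hat F_2=\tfrac12(d\omega_2+d_3\omega_1),\qquad \hat F_3=\tfrac12(d\omega_3+d_1\omega_2);$$ and $\omega$ is parallel with respect to $D$, $D\omega=0$. In particular, local potential functions exist: every point of $M$ has an open neighbourhood $U$ with a smooth function $\mu:U\to\mathbb R$ such that, on $U$, $$\hat F_1=\tfrac12(dd_1+d_2d_3)\mu,\qquad \hat F_2=\tfrac12(dd_2+d_3d_1)\mu,\qquad \hat F_3=\tfrac12(dd_3+d_1d_2)\mu.$$ -/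

import Mathlib

open Bundle VectorField
open scoped Manifold ContDiff Topology

namespace HKT

noncomputable section

section Forms

variable {E : Type*} [NormedAddCommGroup E] [NormedSpace ℝ E]
  {M : Type*} [TopologicalSpace M] [ChartedSpace E M]

/-- One-forms on `M` (smoothness is a separate predicate). -/
abbrev OneForm (E : Type*) [NormedAddCommGroup E] [NormedSpace ℝ E]
    (M : Type*) [TopologicalSpace M] [ChartedSpace E M] :=
  Π x : M, TangentSpace 𝓘(ℝ, E) x →L[ℝ] ℝ

/-- Fields of bilinear functions of two tangent vectors; two-forms are regarded as such. -/
abbrev TwoTensor (E : Type*) [NormedAddCommGroup E] [NormedSpace ℝ E]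
    (M : Type*) [TopologicalSpace M] [ChartedSpace E M] :=
  Π x : M, TangentSpace 𝓘(ℝ, E) x → TangentSpace 𝓘(ℝ, E) x → ℝ

/-- Fields of endomorphisms of the tangent bundle. -/
abbrev EndField (E : Type*) [NormedAddCommGroup E] [NormedSpace ℝ E]
    (M : Type*) [TopologicalSpace M] [ChartedSpace E M] :=
  Π x : M, TangentSpace 𝓘(ℝ, E) x →L[ℝ] TangentSpace 𝓘(ℝ, E) x

/-- Vector fields on `M`. -/
abbrev VecField (E : Type*) [NormedAddCommGroup E] [NormedSpace ℝ E]
    (M : Type*) [TopologicalSpace M] [ChartedSpace E M] :=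
  Π x : M, TangentSpace 𝓘(ℝ, E) x

/-- The image `J Y` of a vector field under a field of endomorphisms. -/
def applyEnd (J : EndField E M) (Y : VecField E M) : VecField E M := fun x ↦ J x (Y x)

/-- The derivative `W f` of a function along a vector field. -/
def dirDeriv (W : VecField E M) (f : M → ℝ) (x : M) : ℝ := mvfderiv 𝓘(ℝ, E) f x (W x)

/-- The action `(J α)(u) = -α(J u)` of an endomorphism field on one-forms. -/
def actOne (J : EndField E M) (α : OneForm E M) : OneForm E M := fun x ↦ -(α x).comp (J x)

/-- The action `(J β)(u, v) = β(J u, J v)` of an endomorphism field on two-forms. -/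
def actTwo (J : EndField E M) (β : TwoTensor E M) : TwoTensor E M :=
  fun x u v ↦ β x (J x u) (J x v)

/-- The expression `X (α Y) - Y (α X) - α [X, Y]`. -/
def extDerivAux (α : OneForm E M) (X Y : VecField E M) (x : M) : ℝ :=
  dirDeriv X (fun y ↦ α y (Y y)) x - dirDeriv Y (fun y ↦ α y (X y)) x
    - α x (mlieBracket 𝓘(ℝ, E) X Y x)

theorem extDerivAux_swap (α : OneForm E M) (X Y : VecField E M) (x : M) :
    extDerivAux α X Y x = -extDerivAux α Y X x := by
  simp only [extDerivAux]
  rw [mlieBracket_swap]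
  simp
  ring

variable [IsManifold 𝓘(ℝ, E) ∞ M]

/-- The one-form `α` is differentiable at `x`, as a section of the cotangent bundle. -/
def DiffFormAt (α : OneForm E M) (x : M) : Prop :=
  MDifferentiableAt 𝓘(ℝ, E) (𝓘(ℝ, E).prod 𝓘(ℝ, E →L[ℝ] ℝ))
    (fun y ↦ TotalSpace.mk' (E →L[ℝ] ℝ)
      (E := fun y : M ↦ TangentSpace 𝓘(ℝ, E) y →L[ℝ] Bundle.Trivial M ℝ y) y (α y)) x

/-- The one-form `α` is smooth. -/
def SmoothForm (α : OneForm E M) : Prop :=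
  ContMDiff 𝓘(ℝ, E) (𝓘(ℝ, E).prod 𝓘(ℝ, E →L[ℝ] ℝ)) ∞
    (fun y ↦ TotalSpace.mk' (E →L[ℝ] ℝ)
      (E := fun y : M ↦ TangentSpace 𝓘(ℝ, E) y →L[ℝ] Bundle.Trivial M ℝ y) y (α y))

/-- The endomorphism field `J` is smooth. -/
def SmoothEnd (J : EndField E M) : Prop :=
  ContMDiff 𝓘(ℝ, E) (𝓘(ℝ, E).prod 𝓘(ℝ, E →L[ℝ] E)) ∞
    (fun y ↦ TotalSpace.mk' (E →L[ℝ] E)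
      (E := fun y : M ↦ TangentSpace 𝓘(ℝ, E) y →L[ℝ] TangentSpace 𝓘(ℝ, E) y) y (J y))

/-- The exterior derivative of a one-form,
`dα(u, v) = X (α Y) - Y (α X) - α [X, Y]` where `X`, `Y` extend `u`, `v` to vector fields
near `x`. The choice of the extensions does not matter: see `extDeriv_apply`. -/
def extDeriv (α : OneForm E M) : TwoTensor E M := fun x u v ↦
  extDerivAux α (FiberBundle.extend E u) (FiberBundle.extend E v) x

theorem mdiffAt_apply {α : OneForm E M} {Y : VecField E M} {x : M}
    (hα : DiffFormAt α x) (hY : MDiffAt (T% Y) x) :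
    MDifferentiableAt 𝓘(ℝ, E) 𝓘(ℝ, ℝ) (fun y ↦ α y (Y y)) x := by
  have h := MDifferentiableAt.clm_bundle_apply (F₁ := E) (F₂ := ℝ)
    (E₁ := (TangentSpace 𝓘(ℝ, E) : M → Type _)) (E₂ := Bundle.Trivial M ℝ)
    (b := fun y : M ↦ y) hα hY
  simp only [mdifferentiableAt_totalSpace] at h
  exact h.2

theorem extDerivAux_tensorial [CompleteSpace E] {α : OneForm E M} {Y : VecField E M} {x : M}
    (hα : DiffFormAt α x) :
    TensorialAt 𝓘(ℝ, E) E (fun X : VecField E M ↦ extDerivAux α X Y x) x where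
  smul := by
    intro f X hf hX
    have h1 := mdiffAt_apply hα hX
    have h2 : (fun y ↦ α y ((f • X) y)) = f * fun y ↦ α y (X y) := by
      ext y; simp
    simp only [extDerivAux, dirDeriv, h2]
    rw [mvfderiv_mul hf h1, mlieBracket_smul_left hf hX]
    simp
    ring
  add := by
    intro X X' hX hX'
    have h1 := mdiffAt_apply hα hX
    have h1' := mdiffAt_apply hα hX'
    have h2 : (fun y ↦ α y ((X + X') y)) = (fun y ↦ α y (X y)) + fun y ↦ α y (X' y) := by
      ext y; simp
    simp only [extDerivAux, dirDeriv, h2]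
    rw [mvfderiv_add h1 h1', mlieBracket_add_left hX hX']
    simp
    ring

theorem extDeriv_apply [FiniteDimensional ℝ E] {α : OneForm E M} {X Y : VecField E M} {x : M}
    (hα : DiffFormAt α x) (hX : MDiffAt (T% X) x) (hY : MDiffAt (T% Y) x) :
    extDeriv α x (X x) (Y x) = extDerivAux α X Y x := by
  have : CompleteSpace E := FiniteDimensional.complete ℝ E
  have key : ∀ Z W W' : VecField E M, MDiffAt (T% W) x →
      MDiffAt (T% W') x → W x = W' x → extDerivAux α W Z x = extDerivAux α W' Z x :=
    fun Z W W' hW hW' h ↦ (extDerivAux_tensorial hα).pointwise hW hW' h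
  have hX' := FiberBundle.mdifferentiableAt_extend 𝓘(ℝ, E) E (X x)
  have hY' := FiberBundle.mdifferentiableAt_extend 𝓘(ℝ, E) E (Y x)
  rw [extDeriv, key _ _ X hX' hX (by simp), extDerivAux_swap, key X _ Y hY' hY (by simp),
    ← extDerivAux_swap]

end Forms

section Geometry

variable {E : Type*} [NormedAddCommGroup E] [NormedSpace ℝ E]
  {M : Type*} [TopologicalSpace M] [ChartedSpace E M] [IsManifold 𝓘(ℝ, E) ∞ M]

/-- The operator `d_J μ = J dμ` on functions. -/
def dFun (J : EndField E M) (μ : M → ℝ) : OneForm E M :=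
  actOne J (fun x ↦ mvfderiv 𝓘(ℝ, E) μ x)

/-- The operator `d_J α = -J d(J α)` on one-forms, that is, `(-1)^k J d J` for `k = 1`. -/
def dOne (J : EndField E M) (α : OneForm E M) : TwoTensor E M :=
  -actTwo J (extDeriv (actOne J α))

/-- The totally antisymmetric symbol with `ε 0 1 2 = 1`. -/
def leviCivita (r s t : Fin 3) : ℝ :=
  if s = r + 1 ∧ t = r + 2 then 1 else if s = r + 2 ∧ t = r + 1 then -1 else 0

/-- The Lie derivative `(L_W J) Y = [W, J Y] - J [W, Y]` of an endomorphism field. -/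
def lieEnd (W : VecField E M) (J : EndField E M) (Y : VecField E M) : VecField E M :=
  fun x ↦ mlieBracket 𝓘(ℝ, E) W (applyEnd J Y) x - J x (mlieBracket 𝓘(ℝ, E) W Y x)

/-- The Nijenhuis expression `[J X, J Y] - J [J X, Y] - J [X, J Y] - [X, Y]`. -/
def nijenhuis (J : EndField E M) (X Y : VecField E M) : VecField E M :=
  fun x ↦ mlieBracket 𝓘(ℝ, E) (applyEnd J X) (applyEnd J Y) x
    - J x (mlieBracket 𝓘(ℝ, E) (applyEnd J X) Y x)
    - J x (mlieBracket 𝓘(ℝ, E) X (applyEnd J Y) x)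
    - mlieBracket 𝓘(ℝ, E) X Y x

/-- `J` is an integrable complex structure: a smooth almost complex structure whose Nijenhuis
tensor vanishes. -/
structure IsComplexStructure (J : EndField E M) : Prop where
  smooth : SmoothEnd J
  sq : ∀ (x : M) (u : TangentSpace 𝓘(ℝ, E) x), J x (J x u) = -u
  integrable : ∀ (x : M) (X Y : VecField E M), MDiffAt (T% X) x → MDiffAt (T% Y) x →
    nijenhuis J X Y x = 0

variable [RiemannianBundle (fun x : M ↦ TangentSpace 𝓘(ℝ, E) x)]

/-- A hypercomplex structure `J 0, J 1, J 2` (the `I₁, I₂, I₃` of the literature), each of whose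
members is orthogonal for the Riemannian metric. -/
structure IsHyperhermitian (J : Fin 3 → EndField E M) : Prop where
  complex : ∀ r, IsComplexStructure (J r)
  mul : ∀ (x : M) (u : TangentSpace 𝓘(ℝ, E) x), J 0 x (J 1 x u) = J 2 x u
  mul_swap : ∀ (x : M) (u : TangentSpace 𝓘(ℝ, E) x), J 1 x (J 0 x u) = -J 2 x u
  orthogonal : ∀ r (x : M) (u v : TangentSpace 𝓘(ℝ, E) x),
    inner ℝ (J r x u) (J r x v) = inner ℝ u v

/-- The fundamental two-form `F(u, v) = g(J u, v)`. -/
def fundamentalForm (J : EndField E M) : TwoTensor E M := fun x u v ↦ inner ℝ (J x u) v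

/-- The one-form `g(V, ·)` dual to a vector field `V`. -/
def dualForm (V : VecField E M) : OneForm E M := fun x ↦ innerSL ℝ (V x)

/-- `W` is a Killing field: `(L_W g)(Y, Z) = W g(Y, Z) - g([W, Y], Z) - g(Y, [W, Z])` vanishes. -/
def IsKilling (W : VecField E M) : Prop :=
  ∀ (x : M) (Y Z : VecField E M), MDiffAt (T% Y) x → MDiffAt (T% Z) x →
    dirDeriv W (fun y ↦ inner ℝ (Y y) (Z y)) x
      - inner ℝ (mlieBracket 𝓘(ℝ, E) W Y x) (Z x)
      - inner ℝ (Y x) (mlieBracket 𝓘(ℝ, E) W Z x) = 0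

/-- A potential one-form: a smooth one-form `η` with
`F_r = (dη_r + d_s η_t) / 2` for cyclic `(r, s, t)`, where `η_r = I_r η`. -/
structure IsPotentialOneForm (J : Fin 3 → EndField E M) (η : OneForm E M) : Prop where
  smooth : SmoothForm η
  eq : ∀ (r : Fin 3) (x : M) (u v : TangentSpace 𝓘(ℝ, E) x),
    fundamentalForm (J r) x u v =
      (1 / 2 : ℝ) * (extDeriv (actOne (J r) η) x u v
        + dOne (J (r + 1)) (actOne (J (r + 2)) η) x u v)

/-- `μ` is a potential function on the open set `U`: it is smooth there and
`F_r = (d d_r + d_s d_t) μ / 2` on `U` for cyclic `(r, s, t)`. -/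
structure IsPotentialFunctionOn (J : Fin 3 → EndField E M) (U : Set M) (μ : M → ℝ) : Prop where
  isOpen : IsOpen U
  smooth : ContMDiffOn 𝓘(ℝ, E) 𝓘(ℝ, ℝ) ∞ μ U
  eq : ∀ (r : Fin 3), ∀ x ∈ U, ∀ u v : TangentSpace 𝓘(ℝ, E) x,
    fundamentalForm (J r) x u v =
      (1 / 2 : ℝ) * (extDeriv (dFun (J r) μ) x u v
        + dOne (J (r + 1)) (dFun (J (r + 2)) μ) x u v)

/-- `V` generates a `D(2,1;-1)`-symmetry: `V` and all `I_r V` are Killing fields,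
`L_{I_r V} I_s = ∑ t, ε^{rst} I_t`, and the one-form dual to `V` is closed. -/
structure IsD21Symmetry (J : Fin 3 → EndField E M) (V : VecField E M) : Prop where
  smooth : CMDiff ∞ (T% V)
  killing : IsKilling V
  killing_rotated : ∀ r, IsKilling (applyEnd (J r) V)
  rotates : ∀ (r s : Fin 3) (x : M) (Y : VecField E M), MDiffAt (T% Y) x →
    lieEnd (applyEnd (J r) V) (J s) Y x = ∑ t, leviCivita r s t • J t x (Y x)
  closed : ∀ (x : M) (u v : TangentSpace 𝓘(ℝ, E) x), extDeriv (dualForm V) x u v = 0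

variable [FiniteDimensional ℝ E] [IsContMDiffRiemannianBundle 𝓘(ℝ, E) ∞ E
  (fun x : M ↦ TangentSpace 𝓘(ℝ, E) x)]

/-- `D` is a hyperkähler connection with torsion: a smooth linear connection with `D I_r = 0` and
`D g = 0` for which `c(u, v, w) = g(T(u, v), w)` is a three-form. The torsion is alternating in
`u, v`, so the last condition says that it is skew in `v, w`. -/
structure IsHKTConnection (J : Fin 3 → EndField E M)
    (D : CovariantDerivative 𝓘(ℝ, E) E (TangentSpace 𝓘(ℝ, E) : M → Type _)) : Prop where
  smooth : CovariantDerivative.ContMDiffCovariantDerivative D ∞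
  parallel : ∀ (r : Fin 3) (x : M) (Y : VecField E M), MDiffAt (T% Y) x →
    ∀ u : TangentSpace 𝓘(ℝ, E) x, D (applyEnd (J r) Y) x u = J r x (D Y x u)
  metric : ∀ (x : M) (Y Z : VecField E M), MDiffAt (T% Y) x → MDiffAt (T% Z) x →
    ∀ u : TangentSpace 𝓘(ℝ, E) x, mvfderiv 𝓘(ℝ, E) (fun y ↦ inner ℝ (Y y) (Z y)) x u
      = inner ℝ (D Y x u) (Z x) + inner ℝ (Y x) (D Z x u)
  torsion_skew : ∀ (x : M) (u v w : TangentSpace 𝓘(ℝ, E) x),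
    inner ℝ (D.torsion x u v) w = -inner ℝ (D.torsion x u w) v

/-- The one-form `η` is parallel for `D`: `(D_u η)(Y) = u (η Y) - η (D_u Y)` vanishes. -/
def IsParallelForm (D : CovariantDerivative 𝓘(ℝ, E) E (TangentSpace 𝓘(ℝ, E) : M → Type _))
    (η : OneForm E M) : Prop :=
  ∀ (x : M) (Y : VecField E M), MDiffAt (T% Y) x → ∀ u : TangentSpace 𝓘(ℝ, E) x,
    mvfderiv 𝓘(ℝ, E) (fun y ↦ η y (Y y)) x u - η x (D Y x u) = 0

end Geometry

end

end HKT

/-! For a metric connection `D` with skew torsion, a field `W` is Killing only if `D W` is a skew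
endomorphism. With A = DV, the parallelism of the I_r gives D(I_r V) = I_r A, so A and all I_r A are
skew. Then A anticommutes with each I_r, hence commutes with I_3 = I_1 I_2 while also anticommuting
with it, and A = 0 (`eq_zero_of_skew_of_skew`). Thus V and all W = I_r V are parallel.

For parallel W, the dual form has dW♭(u, v) = g(T(W, u), v) (`extDeriv_dualForm`), and the Lie
derivative along W differs from D_W by the algebraic operator -T(W, ·). The rotation condition
therefore becomes a commutator identity between T(I_r V, ·) and I_s (`torsion_rotated`). Paired with
I_s v, it is the potential equation for ω = -2 V♭.

Closedness of V♭ enters only through the Poincaré lemma in a chart (`exists_local_primitive`), which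
gives dμ = ω locally. -/

namespace HKT

/-! ### Poincaré lemma for one-forms on a manifold -/

section Poincare

variable {E : Type*} [NormedAddCommGroup E] [NormedSpace ℝ E]
  {M : Type*} [TopologicalSpace M] [ChartedSpace E M] [IsManifold 𝓘(ℝ, E) ∞ M]

/-- The vector field on a normed space with constant value `u`. -/
def constField (u : E) : VecField E E := fun _ ↦ u

/-- The coordinate vector field of the chart at `x` with constant value `u`. -/
noncomputable def coordField (x : M) (u : E) : VecField E M :=
  mpullback 𝓘(ℝ, E) 𝓘(ℝ, E) (extChartAt 𝓘(ℝ, E) x) (constField u)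

theorem isInvertible_mfderiv_chart {x y : M} (hy : y ∈ (extChartAt 𝓘(ℝ, E) x).source) :
    (mfderiv 𝓘(ℝ, E) 𝓘(ℝ, E) (extChartAt 𝓘(ℝ, E) x) y).IsInvertible :=
  isInvertible_mfderiv_extChartAt hy

theorem contMDiffAt_extChartAt_of_mem {x y : M} (hy : y ∈ (extChartAt 𝓘(ℝ, E) x).source) :
    ContMDiffAt 𝓘(ℝ, E) 𝓘(ℝ, E) ∞ (extChartAt 𝓘(ℝ, E) x) y :=
  contMDiffAt_extChartAt' (by simpa using hy)

theorem mfderiv_coordField {x y : M} (hy : y ∈ (extChartAt 𝓘(ℝ, E) x).source) (u : E) :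
    mfderiv 𝓘(ℝ, E) 𝓘(ℝ, E) (extChartAt 𝓘(ℝ, E) x) y (coordField x u y) = u := by
  simp only [coordField, mpullback_apply]
  exact (isInvertible_mfderiv_chart hy).self_apply_inverse (y := u)

theorem contMDiffAt_const_vecField (u e : E) :
    ContMDiffAt 𝓘(ℝ, E) 𝓘(ℝ, E).tangent ∞
      (T% (constField u)) e := by
  rw [contMDiffAt_vectorSpace_iff_contDiffAt]
  exact contDiffAt_const

theorem contMDiffAt_coordField [FiniteDimensional ℝ E] {x y : M} (hy : y ∈ (extChartAt 𝓘(ℝ, E) x).source) (u : E) :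
    ContMDiffAt 𝓘(ℝ, E) 𝓘(ℝ, E).tangent ∞ (T% (coordField x u)) y := by
  have : CompleteSpace E := FiniteDimensional.complete ℝ E
  exact ContMDiffAt.mpullback_vectorField_preimage (n := ∞) (contMDiffAt_const_vecField u _)
    (contMDiffAt_extChartAt_of_mem hy) (isInvertible_mfderiv_chart hy) (by simp)

/-- Pullback commutes with the bracket, and constant fields commute. On coordinate fields the
bracket term of the exterior derivative thus disappears. -/
theorem mlieBracket_coordField [FiniteDimensional ℝ E] {x y : M} (hy : y ∈ (extChartAt 𝓘(ℝ, E) x).source) (u v : E) :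
    mlieBracket 𝓘(ℝ, E) (coordField x u) (coordField x v) y = 0 := by
  have : CompleteSpace E := FiniteDimensional.complete ℝ E
  have : IsManifold 𝓘(ℝ, E) (minSmoothness ℝ 2) M := IsManifold.of_le (n := ∞) (by simpa using ENat.LEInfty.out)
  rw [coordField, coordField, ← mpullback_mlieBracket (n := ∞)
    ((contMDiffAt_const_vecField u _).mdifferentiableAt (by simp))
    ((contMDiffAt_const_vecField v _).mdifferentiableAt (by simp))
    (contMDiffAt_extChartAt_of_mem hy) (by simpa using ENat.LEInfty.out)]
  rw [mpullback_apply, ← mlieBracketWithin_univ, mlieBracketWithin_eq_lieBracketWithin]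
  have : lieBracketWithin ℝ (constField u) (constField v) Set.univ = fun _ ↦ (0 : E) := by
    ext e
    change fderivWithin ℝ (fun _ : E ↦ v) Set.univ e u
      - fderivWithin ℝ (fun _ : E ↦ u) Set.univ e v = 0
    simp
  rw [this]
  exact map_zero _

theorem contMDiffAt_apply {α : OneForm E M} (hα : SmoothForm α) {Y : VecField E M} {y : M}
    (hY : ContMDiffAt 𝓘(ℝ, E) 𝓘(ℝ, E).tangent ∞ (T% Y) y) :
    ContMDiffAt 𝓘(ℝ, E) 𝓘(ℝ, ℝ) ∞ (fun z ↦ α z (Y z)) y := by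
  have h := ContMDiffAt.clm_bundle_apply (F₁ := E) (F₂ := ℝ)
    (E₁ := (TangentSpace 𝓘(ℝ, E) : M → Type _)) (E₂ := Bundle.Trivial M ℝ)
    (b := fun y : M ↦ y) (hα y) hY
  simp only [contMDiffAt_totalSpace] at h
  exact h.2

theorem SmoothForm.diffFormAt {α : OneForm E M} (hα : SmoothForm α) (x : M) : DiffFormAt α x :=
  (hα x).mdifferentiableAt (by simp)

/-- The expression of a one-form in the chart at `x`. -/
noncomputable def chartForm (α : OneForm E M) (x : M) (e : E) : E →L[ℝ] ℝ :=
  (α ((extChartAt 𝓘(ℝ, E) x).symm e)).comp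
    (mfderiv 𝓘(ℝ, E) 𝓘(ℝ, E) (extChartAt 𝓘(ℝ, E) x) ((extChartAt 𝓘(ℝ, E) x).symm e)).inverse

omit [IsManifold 𝓘(ℝ, E) ∞ M] in
theorem chartForm_apply (α : OneForm E M) (x : M) (e u : E) :
    chartForm α x e u = α ((extChartAt 𝓘(ℝ, E) x).symm e)
      (coordField x u ((extChartAt 𝓘(ℝ, E) x).symm e)) := rfl

variable [FiniteDimensional ℝ E]

theorem contDiffOn_chartForm {α : OneForm E M} (hα : SmoothForm α) (x : M) :
    ContDiffOn ℝ ∞ (chartForm α x) (extChartAt 𝓘(ℝ, E) x).target := by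
  rw [contDiffOn_clm_apply]
  intro u e he
  have h1 := contMDiffAt_apply hα
    (contMDiffAt_coordField ((extChartAt 𝓘(ℝ, E) x).map_target he) u)
  have h2 := contMDiffOn_extChartAt_symm (I := 𝓘(ℝ, E)) (n := ∞) x e he
  exact (h1.comp_contMDiffWithinAt e h2).contDiffWithinAt

/-- The chain rule through the chart; it turns closedness of `α` into symmetry of the derivative of
`chartForm α x`. -/
theorem dirDeriv_coordField {α : OneForm E M} (hα : SmoothForm α) {x : M} {e : E}
    (he : e ∈ (extChartAt 𝓘(ℝ, E) x).target) (u v : E) :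
    dirDeriv (coordField x u) (fun y ↦ α y (coordField x v y)) ((extChartAt 𝓘(ℝ, E) x).symm e)
      = fderiv ℝ (chartForm α x) e u v := by
  set y := (extChartAt 𝓘(ℝ, E) x).symm e with hye
  have hy : y ∈ (extChartAt 𝓘(ℝ, E) x).source := (extChartAt 𝓘(ℝ, E) x).map_target he
  have hey : extChartAt 𝓘(ℝ, E) x y = e := (extChartAt 𝓘(ℝ, E) x).right_inv he
  have hopen : IsOpen (extChartAt 𝓘(ℝ, E) x).target := isOpen_extChartAt_target x
  have hd : DifferentiableAt ℝ (chartForm α x) e :=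
    ((contDiffOn_chartForm hα x).contDiffAt (hopen.mem_nhds he)).differentiableAt (by simp)
  have hd' : HasFDerivAt (fun e' ↦ chartForm α x e' v)
      ((fderiv ℝ (chartForm α x) e).flip v) e := by
    simpa using hd.hasFDerivAt.clm_apply (hasFDerivAt_const v e)
  have heq : (fun z ↦ α z (coordField x v z)) =ᶠ[𝓝 y]
      (fun e' ↦ chartForm α x e' v) ∘ extChartAt 𝓘(ℝ, E) x := by
    filter_upwards [(isOpen_extChartAt_source (I := 𝓘(ℝ, E)) x).mem_nhds hy] with z hz
    simp only [Function.comp_apply, chartForm_apply]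
    rw [(extChartAt 𝓘(ℝ, E) x).left_inv hz]
  have hm : HasMFDerivAt 𝓘(ℝ, E) 𝓘(ℝ, ℝ)
      ((fun e' ↦ chartForm α x e' v) ∘ extChartAt 𝓘(ℝ, E) x) y
      (((fderiv ℝ (chartForm α x) e).flip v).comp
        (mfderiv 𝓘(ℝ, E) 𝓘(ℝ, E) (extChartAt 𝓘(ℝ, E) x) y)) := by
    refine HasMFDerivAt.comp y ?_
      ((contMDiffAt_extChartAt_of_mem hy).mdifferentiableAt (by simp)).hasMFDerivAt
    rw [hey]
    exact hd'.hasMFDerivAt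
  have := (hm.congr_of_eventuallyEq heq).mfderiv
  change mfderiv 𝓘(ℝ, E) 𝓘(ℝ, ℝ) (fun z ↦ α z (coordField x v z)) y (coordField x u y) = _
  rw [this]
  change ((fderiv ℝ (chartForm α x) e).flip v) (mfderiv 𝓘(ℝ, E) 𝓘(ℝ, E)
    (extChartAt 𝓘(ℝ, E) x) y (coordField x u y)) = _
  rw [mfderiv_coordField hy]
  rfl

/-- A closed smooth one-form is locally exact. -/
theorem exists_local_primitive {α : OneForm E M} (hα : SmoothForm α)
    (hclosed : ∀ (x : M) (u v : TangentSpace 𝓘(ℝ, E) x), extDeriv α x u v = 0) (x : M) :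
    ∃ (U : Set M) (μ : M → ℝ), x ∈ U ∧ IsOpen U ∧ ContMDiffOn 𝓘(ℝ, E) 𝓘(ℝ, ℝ) ∞ μ U ∧
      ∀ y ∈ U, mvfderiv 𝓘(ℝ, E) μ y = α y := by
  have hopen : IsOpen (extChartAt 𝓘(ℝ, E) x).target := isOpen_extChartAt_target x
  -- A ball inside the chart target supplies the convexity on which a symmetric derivative
  -- integrates.
  obtain ⟨ε, hε, hball⟩ := Metric.isOpen_iff.1 hopen _ (mem_extChartAt_target x)
  set B := Metric.ball (extChartAt 𝓘(ℝ, E) x x) ε with hB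
  have hsm : ContDiffOn ℝ ∞ (chartForm α x) B := (contDiffOn_chartForm hα x).mono hball
  obtain ⟨F, hF⟩ := (convex_ball _ _ : Convex ℝ B).exists_forall_hasFDerivAt_of_fderiv_symmetric
    Metric.isOpen_ball (hsm.differentiableOn (by simp)) (fun e he u v ↦ by
      have hy := (extChartAt 𝓘(ℝ, E) x).map_target (hball he)
      have h := hclosed _ (coordField x u ((extChartAt 𝓘(ℝ, E) x).symm e))
        (coordField x v ((extChartAt 𝓘(ℝ, E) x).symm e))
      rw [extDeriv_apply (hα.diffFormAt _)
        ((contMDiffAt_coordField hy u).mdifferentiableAt (by simp))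
        ((contMDiffAt_coordField hy v).mdifferentiableAt (by simp)), extDerivAux,
        mlieBracket_coordField hy, map_zero, sub_zero, dirDeriv_coordField hα (hball he),
        dirDeriv_coordField hα (hball he)] at h
      exact sub_eq_zero.1 h)
  -- The derivative of `F` is the smooth `chartForm α x`, so `F` is smooth.
  have hFs : ContDiffOn ℝ ∞ F B := by
    rw [contDiffOn_infty_iff_fderiv_of_isOpen Metric.isOpen_ball]
    exact ⟨fun e he ↦ (hF e he).differentiableAt.differentiableWithinAt,
      hsm.congr fun e he ↦ (hF e he).fderiv⟩
  refine ⟨(extChartAt 𝓘(ℝ, E) x).source ∩ extChartAt 𝓘(ℝ, E) x ⁻¹' B, F ∘ extChartAt 𝓘(ℝ, E) x,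
    ⟨mem_extChartAt_source x, Metric.mem_ball_self hε⟩, ?_, ?_, ?_⟩
  · exact (continuousOn_extChartAt x).isOpen_inter_preimage
      (isOpen_extChartAt_source x) Metric.isOpen_ball
  · intro y hy
    have h1 : ContMDiffAt 𝓘(ℝ, E) 𝓘(ℝ, ℝ) ∞ F (extChartAt 𝓘(ℝ, E) x y) :=
      (hFs.contDiffAt (Metric.isOpen_ball.mem_nhds hy.2)).contMDiffAt
    exact (h1.comp y (contMDiffAt_extChartAt_of_mem hy.1)).contMDiffWithinAt
  · intro y hy
    have h1 := (hF _ hy.2).hasMFDerivAt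
    have h2 := HasMFDerivAt.comp y h1
      ((contMDiffAt_extChartAt_of_mem hy.1).mdifferentiableAt (by simp)).hasMFDerivAt
    ext w
    change mfderiv 𝓘(ℝ, E) 𝓘(ℝ, ℝ) (F ∘ extChartAt 𝓘(ℝ, E) x) y w = _
    rw [h2.mfderiv]
    change chartForm α x (extChartAt 𝓘(ℝ, E) x y)
      (mfderiv 𝓘(ℝ, E) 𝓘(ℝ, E) (extChartAt 𝓘(ℝ, E) x) y w) = _
    refine (chartForm_apply α x _ _).trans ?_
    rw [(extChartAt 𝓘(ℝ, E) x).left_inv hy.1]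
    congr 1
    exact (isInvertible_mfderiv_chart hy.1).inverse_apply_self (y := w)

end Poincare
-- Skew endomorphisms and quaternionic triples
section LinearAlgebra

variable {T : Type*} [NormedAddCommGroup T] [InnerProductSpace ℝ T]

/-- An endomorphism `A` is zero if `A` and all `J r A` are skew, for an orthogonal quaternionic
triple `J`. -/
theorem eq_zero_of_skew_of_skew {J : Fin 3 → T →L[ℝ] T} {A : T →L[ℝ] T}
    (hsq : ∀ r u, J r (J r u) = -u) (hmul : ∀ u, J 0 (J 1 u) = J 2 u)
    (hJ : ∀ r u v, inner ℝ (J r u) v = -inner ℝ u (J r v))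
    (hA : ∀ u v, inner ℝ (A u) v + inner ℝ u (A v) = 0)
    (hJA : ∀ r u v, inner ℝ (J r (A u)) v + inner ℝ u (J r (A v)) = 0) : A = 0 := by
  have anti : ∀ r u, J r (A u) = -A (J r u) := by
    intro r u
    refine ext_inner_right ℝ fun v ↦ ?_
    have h1 := hJA r u v
    have h2 := hJ r u (A v)
    have h3 := hA (J r u) v
    rw [inner_neg_left]
    linarith
  ext u
  -- Moving `A` past both factors of `J 2 = J 0 ∘ J 1` costs two signs, moving it past `J 2`
  -- directly costs one.
  have h : J 2 (A u) = -J 2 (A u) := by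
    conv_lhs => rw [← hmul, anti 1, map_neg, anti 0, neg_neg, hmul]
    rw [anti 2, neg_neg]
  have h0 : J 2 (A u) = 0 := by
    have h2 : (2 : ℝ) • J 2 (A u) = 0 := by
      rw [two_smul]
      exact add_eq_zero_iff_eq_neg.2 h
    simpa using h2
  have h1 := hsq 2 (A u)
  rw [h0, map_zero] at h1
  simpa using h1.symm

end LinearAlgebra

/-! ### Dual forms, quaternionic relations, and Killing fields of an HKT-connection -/

section Geometry

variable {E : Type*} [NormedAddCommGroup E] [NormedSpace ℝ E]
  {M : Type*} [TopologicalSpace M] [ChartedSpace E M] [IsManifold 𝓘(ℝ, E) ∞ M]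

theorem contMDiff_applyEnd {J : EndField E M} (hJ : SmoothEnd J) {V : VecField E M}
    (hV : CMDiff ∞ (T% V)) : CMDiff ∞ (T% (applyEnd J V)) :=
  ContMDiff.clm_bundle_apply (F₁ := E) (F₂ := E)
    (E₁ := (TangentSpace 𝓘(ℝ, E) : M → Type _)) (E₂ := (TangentSpace 𝓘(ℝ, E) : M → Type _))
    (b := fun y : M ↦ y) hJ hV

theorem mdiffAt_applyEnd {J : EndField E M} (hJ : SmoothEnd J) {Y : VecField E M} {x : M}
    (hY : MDiffAt (T% Y) x) : MDiffAt (T% (applyEnd J Y)) x :=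
  MDifferentiableAt.clm_bundle_apply (F₁ := E) (F₂ := E)
    (E₁ := (TangentSpace 𝓘(ℝ, E) : M → Type _)) (E₂ := (TangentSpace 𝓘(ℝ, E) : M → Type _))
    (b := fun y : M ↦ y) ((hJ x).mdifferentiableAt (by simp)) hY

theorem mlieBracket_eq_sub_torsion [FiniteDimensional ℝ E]
    {D : CovariantDerivative 𝓘(ℝ, E) E (TangentSpace 𝓘(ℝ, E) : M → Type _)}
    {X Y : VecField E M} {x : M} (hX : MDiffAt (T% X) x)
    (hY : MDiffAt (T% Y) x) :
    mlieBracket 𝓘(ℝ, E) X Y x = D Y x (X x) - D X x (Y x) - D.torsion x (X x) (Y x) := by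
  rw [D.torsion_apply hX hY]
  abel

theorem extDeriv_const_smul {α : OneForm E M} {x : M} (hα : DiffFormAt α x) (c : ℝ)
    (u v : TangentSpace 𝓘(ℝ, E) x) :
    extDeriv (fun y ↦ c • α y) x u v = c * extDeriv α x u v := by
  have key : ∀ W Z : VecField E M, MDiffAt (T% Z) x →
      dirDeriv W (fun y ↦ (c • α y) (Z y)) x = c * dirDeriv W (fun y ↦ α y (Z y)) x := by
    intro W Z hZ
    have h : (fun y ↦ (c • α y) (Z y)) = (fun _ ↦ c) * fun y ↦ α y (Z y) := rfl
    rw [dirDeriv, h, mvfderiv_mul mdifferentiableAt_const (mdiffAt_apply hα hZ)]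
    simp [dirDeriv, mvfderiv_const]
  have hu := FiberBundle.mdifferentiableAt_extend 𝓘(ℝ, E) E u
  have hv := FiberBundle.mdifferentiableAt_extend 𝓘(ℝ, E) E v
  rw [extDeriv, extDeriv, extDerivAux, extDerivAux, key _ _ hu, key _ _ hv]
  simp only [smul_apply, smul_eq_mul]
  ring

/-- The exterior derivative depends only on the germ; this matters because a primitive exists only
on an open set. -/
theorem extDeriv_congr {α β : OneForm E M} {x : M} (h : ∀ᶠ y in 𝓝 x, α y = β y) :
    extDeriv α x = extDeriv β x := by
  have key : ∀ W Z : VecField E M,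
      dirDeriv W (fun y ↦ α y (Z y)) x = dirDeriv W (fun y ↦ β y (Z y)) x := by
    intro W Z
    have : (fun y ↦ α y (Z y)) =ᶠ[𝓝 x] fun y ↦ β y (Z y) := h.mono fun y hy ↦ by
      simp only [hy]
    simp only [dirDeriv, mvfderiv]
    rw [this.mfderiv_eq, this.eq_of_nhds]
    rfl
  funext u v
  simp only [extDeriv, extDerivAux, key, h.self_of_nhds]

variable [RiemannianBundle (fun x : M ↦ TangentSpace 𝓘(ℝ, E) x)]
  {J : Fin 3 → EndField E M}

theorem IsHyperhermitian.inner_left (hJ : IsHyperhermitian J) (r : Fin 3) (x : M)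
    (u v : TangentSpace 𝓘(ℝ, E) x) : inner ℝ (J r x u) v = -inner ℝ u (J r x v) := by
  rw [← hJ.orthogonal r x u (J r x v), (hJ.complex r).sq, inner_neg_right, neg_neg]

theorem IsHyperhermitian.mul_cyclic (hJ : IsHyperhermitian J) (r : Fin 3) (x : M)
    (u : TangentSpace 𝓘(ℝ, E) x) : J r x (J (r + 1) x u) = J (r + 2) x u := by
  have sq := fun r ↦ (hJ.complex r).sq x
  have h12 : ∀ u, J 1 x (J 2 x u) = J 0 x u := fun u ↦ by
    have h := hJ.mul_swap x (J 1 x u)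
    rw [hJ.mul] at h
    have h' := hJ.mul x (J 1 x u)
    rw [sq, map_neg] at h'
    rw [h, ← h', neg_neg]
  fin_cases r
  · exact hJ.mul x u
  · exact h12 u
  · have h := sq 1 (J 2 x (J 0 x u))
    rw [h12, sq, map_neg] at h
    exact (neg_injective h).symm

/-- The adjoint of `mul_cyclic`, since each `J r` is skew for the metric. -/
theorem IsHyperhermitian.mul_cyclic_swap (hJ : IsHyperhermitian J) (r : Fin 3) (x : M)
    (u : TangentSpace 𝓘(ℝ, E) x) : J (r + 1) x (J r x u) = -J (r + 2) x u := by
  refine ext_inner_right ℝ fun v ↦ ?_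
  rw [hJ.inner_left, hJ.inner_left, hJ.mul_cyclic, neg_neg, inner_neg_left, hJ.inner_left, neg_neg]

theorem actOne_dualForm (hJ : IsHyperhermitian J) (r : Fin 3) (W : VecField E M) :
    actOne (J r) (dualForm W) = dualForm (applyEnd (J r) W) := by
  funext x
  ext u
  simp [actOne, dualForm, applyEnd, hJ.inner_left]

/-- The action on forms reverses composition: the product that appears is `J (r + 2) ∘ J (r + 1) =
-J r`, and its sign is the one in `actOne`. -/
theorem actOne_actOne (hJ : IsHyperhermitian J) (r : Fin 3) (η : OneForm E M) :
    actOne (J (r + 1)) (actOne (J (r + 2)) η) = actOne (J r) η := by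
  funext x
  ext u
  have h := hJ.mul_cyclic_swap (r + 1) x u
  rw [add_assoc, add_assoc, show (1 + 1 : Fin 3) = 2 from rfl, show (1 + 2 : Fin 3) = 0 from rfl,
    add_zero] at h
  simp [actOne, h]

theorem smoothForm_dualForm [IsContMDiffRiemannianBundle 𝓘(ℝ, E) ∞ E
    (fun x : M ↦ TangentSpace 𝓘(ℝ, E) x)] {W : VecField E M} (hW : CMDiff ∞ (T% W)) :
    SmoothForm (dualForm W) := by
  obtain ⟨g, hg, hgi⟩ := IsContMDiffRiemannianBundle.exists_contMDiff (IB := 𝓘(ℝ, E)) (n := ∞)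
    (F := E) (E := fun x : M ↦ TangentSpace 𝓘(ℝ, E) x)
  have h := ContMDiff.clm_bundle_apply (F₁ := E) (F₂ := E →L[ℝ] ℝ)
    (E₁ := (TangentSpace 𝓘(ℝ, E) : M → Type _))
    (E₂ := fun y : M ↦ TangentSpace 𝓘(ℝ, E) y →L[ℝ] Bundle.Trivial M ℝ y)
    (b := fun y : M ↦ y) (ϕ := g) hg hW
  have heq : dualForm W = fun x ↦ g x (W x) := by
    funext x
    ext u
    exact hgi x (W x) u
  rw [heq]
  exact h

theorem smoothForm_const_smul_dualForm [IsContMDiffRiemannianBundle 𝓘(ℝ, E) ∞ E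
    (fun x : M ↦ TangentSpace 𝓘(ℝ, E) x)] {V : VecField E M} (hV : CMDiff ∞ (T% V)) (c : ℝ) :
    SmoothForm (fun x ↦ c • dualForm V x) := by
  have h : (fun x ↦ c • dualForm V x) = dualForm (c • V) := by
    funext x
    ext u
    simp [dualForm]
  rw [h]
  exact smoothForm_dualForm (hV.const_smul_section (a := c))

variable [FiniteDimensional ℝ E]
  {D : CovariantDerivative 𝓘(ℝ, E) E (TangentSpace 𝓘(ℝ, E) : M → Type _)}

/-- The covariant derivative of a Killing field is skew. -/
theorem IsHKTConnection.skew_of_isKilling (hD : IsHKTConnection J D) {W : VecField E M}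
    (hW : CMDiff ∞ (T% W)) (hK : IsKilling W) (x : M) (u v : TangentSpace 𝓘(ℝ, E) x) :
    inner ℝ (D W x u) v + inner ℝ u (D W x v) = 0 := by
  have hu := FiberBundle.mdifferentiableAt_extend 𝓘(ℝ, E) E u
  have hv := FiberBundle.mdifferentiableAt_extend 𝓘(ℝ, E) E v
  have hWx : MDiffAt (T% W) x := (hW x).mdifferentiableAt (by simp)
  have h := hK x _ _ hu hv
  rw [dirDeriv, hD.metric x _ _ hu hv, mlieBracket_eq_sub_torsion (D := D) hWx hu,
    mlieBracket_eq_sub_torsion (D := D) hWx hv] at h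
  simp only [FiberBundle.extend_apply_self, inner_sub_left, inner_sub_right] at h
  -- The `D_W` terms have cancelled by metricity; the torsion terms cancel by skewness, leaving only
  -- `D W`.
  have ht := hD.torsion_skew x (W x) u v
  rw [real_inner_comm] at ht
  rw [real_inner_comm v] at h
  linarith [real_inner_comm v (D.torsion x (W x) u), real_inner_comm u (D.torsion x (W x) v)]

theorem IsHKTConnection.parallel_of_isD21Symmetry (hD : IsHKTConnection J D)
    (hJ : IsHyperhermitian J) {V : VecField E M} (hV : IsD21Symmetry J V) (x : M) :
    D V x = 0 := by
  have hVx : MDiffAt (T% V) x := (hV.smooth x).mdifferentiableAt (by simp)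
  refine eq_zero_of_skew_of_skew (J := fun r ↦ J r x) (fun r ↦ (hJ.complex r).sq x) (hJ.mul x)
    (fun r ↦ hJ.inner_left r x) (hD.skew_of_isKilling hV.smooth hV.killing x) fun r u v ↦ ?_
  have h := hD.skew_of_isKilling (contMDiff_applyEnd (hJ.complex r).smooth hV.smooth)
    (hV.killing_rotated r) x u v
  rwa [hD.parallel r x V hVx, hD.parallel r x V hVx] at h

/-- As W is parallel, differentiating g(W, Y) only hits Y, so dW♭(X, Y) = g(W, D_X Y - D_Y X - [X,
Y]) = g(W, T(X, Y)); total skewness of the torsion moves W into the first slot. -/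
theorem IsHKTConnection.extDeriv_dualForm (hD : IsHKTConnection J D) {W : VecField E M}
    (hW : CMDiff ∞ (T% W)) {x : M} (hDW : D W x = 0) (u v : TangentSpace 𝓘(ℝ, E) x) :
    extDeriv (dualForm W) x u v = inner ℝ (D.torsion x (W x) u) v := by
  have hu := FiberBundle.mdifferentiableAt_extend 𝓘(ℝ, E) E u
  have hv := FiberBundle.mdifferentiableAt_extend 𝓘(ℝ, E) E v
  have hWx : MDiffAt (T% W) x := (hW x).mdifferentiableAt (by simp)
  have h1 : ∀ Y : VecField E M, (fun y ↦ dualForm W y (Y y)) = fun y ↦ inner ℝ (W y) (Y y) :=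
    fun Y ↦ rfl
  have h2 : ∀ w, dualForm W x w = inner ℝ (W x) w := fun w ↦ rfl
  rw [extDeriv, extDerivAux, h1, h1, h2, dirDeriv, dirDeriv, hD.metric x _ _ hWx hu,
    hD.metric x _ _ hWx hv, mlieBracket_eq_sub_torsion (D := D) hu hv, hDW]
  simp only [FiberBundle.extend_apply_self, inner_sub_right, zero_apply,
    inner_zero_left]
  have ht := hD.torsion_skew x u v (W x)
  rw [D.torsion_antisymm u (W x), inner_neg_left, neg_neg] at ht
  rw [← ht, real_inner_comm (W x) (D.torsion x u v)]
  ring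

theorem IsHKTConnection.parallel_applyEnd (hD : IsHKTConnection J D)
    (hJ : IsHyperhermitian J) {V : VecField E M} (hV : IsD21Symmetry J V) (r : Fin 3) (x : M) :
    D (applyEnd (J r) V) x = 0 := by
  have hVx : MDiffAt (T% V) x := (hV.smooth x).mdifferentiableAt (by simp)
  ext w
  simp [hD.parallel r x V hVx, hD.parallel_of_isD21Symmetry hJ hV x]

/-- For W = I_r V parallel, [W, Y] = D_W Y - T(W, Y). The D_W part commutes with the complex
structures, so their Lie derivative along W is purely a commutator with T(W, ·). The choice s = r +
1 leaves the single term t = r + 2. -/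
theorem IsHKTConnection.torsion_rotated (hD : IsHKTConnection J D)
    (hJ : IsHyperhermitian J) {V : VecField E M} (hV : IsD21Symmetry J V) (r : Fin 3) (x : M)
    (u : TangentSpace 𝓘(ℝ, E) x) :
    J (r + 1) x (D.torsion x (J r x (V x)) u) - D.torsion x (J r x (V x)) (J (r + 1) x u)
      = J (r + 2) x u := by
  have hu := FiberBundle.mdifferentiableAt_extend 𝓘(ℝ, E) E u
  have hVx : MDiffAt (T% V) x := (hV.smooth x).mdifferentiableAt (by simp)
  have hW : MDiffAt (T% (applyEnd (J r) V)) x := mdiffAt_applyEnd (hJ.complex r).smooth hVx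
  have hDW := hD.parallel_applyEnd hJ hV r x
  have h := hV.rotates r (r + 1) x _ hu
  have hl : ∑ t, leviCivita r (r + 1) t • J t x (FiberBundle.extend E u x) = J (r + 2) x u := by
    rw [Finset.sum_eq_single (r + 2)]
    · simp [leviCivita]
    · intro t _ ht
      simp [leviCivita, ht]
    · simp
  rw [hl, lieEnd, mlieBracket_eq_sub_torsion (D := D) hW (mdiffAt_applyEnd (hJ.complex _).smooth hu),
    mlieBracket_eq_sub_torsion (D := D) hW hu, hD.parallel _ x _ hu, hDW] at h
  simp only [applyEnd, FiberBundle.extend_apply_self, zero_apply, sub_zero,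
    map_sub] at h
  rw [← h]
  abel

end Geometry
-- The potential one-form and local potential functions
section Potential

variable {E : Type*} [NormedAddCommGroup E] [NormedSpace ℝ E] [FiniteDimensional ℝ E]
  {M : Type*} [TopologicalSpace M] [ChartedSpace E M] [IsManifold 𝓘(ℝ, E) ∞ M]
  [RiemannianBundle (fun x : M ↦ TangentSpace 𝓘(ℝ, E) x)]
  [IsContMDiffRiemannianBundle 𝓘(ℝ, E) ∞ E (fun x : M ↦ TangentSpace 𝓘(ℝ, E) x)]
  {J : Fin 3 → EndField E M}
  {D : CovariantDerivative 𝓘(ℝ, E) E (TangentSpace 𝓘(ℝ, E) : M → Type _)}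
  {V : VecField E M}

theorem IsHKTConnection.extDeriv_actOne (hD : IsHKTConnection J D) (hJ : IsHyperhermitian J)
    (hV : IsD21Symmetry J V) (r : Fin 3) (x : M) (u v : TangentSpace 𝓘(ℝ, E) x) :
    extDeriv (actOne (J r) (fun x ↦ (-2 : ℝ) • dualForm V x)) x u v
      = -2 * inner ℝ (D.torsion x (J r x (V x)) u) v := by
  have hW := contMDiff_applyEnd (hJ.complex r).smooth hV.smooth
  have h : actOne (J r) (fun x ↦ (-2 : ℝ) • dualForm V x)
      = fun x ↦ (-2 : ℝ) • dualForm (applyEnd (J r) V) x := by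
    rw [← actOne_dualForm hJ]
    funext x
    ext u
    simp [actOne]
  rw [h, extDeriv_const_smul ((smoothForm_dualForm hW).diffFormAt x),
    hD.extDeriv_dualForm hW (hD.parallel_applyEnd hJ hV r x)]
  rfl

theorem IsHKTConnection.isPotentialOneForm (hD : IsHKTConnection J D) (hJ : IsHyperhermitian J)
    (hV : IsD21Symmetry J V) :
    IsPotentialOneForm J (fun x ↦ (-2 : ℝ) • dualForm V x) where
  smooth := smoothForm_const_smul_dualForm hV.smooth _
  eq r x u v := by
    have h1 : dOne (J (r + 1)) (actOne (J (r + 2)) (fun x ↦ (-2 : ℝ) • dualForm V x)) x u v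
        = -extDeriv (actOne (J r) (fun x ↦ (-2 : ℝ) • dualForm V x)) x
            (J (r + 1) x u) (J (r + 1) x v) := by
      rw [dOne, actOne_actOne hJ]
      rfl
    have h2 := hD.torsion_rotated hJ hV r x u
    have h3 := hJ.mul_cyclic (r + 1) x u
    rw [add_assoc, add_assoc, show (1 + 1 : Fin 3) = 2 from rfl,
      show (1 + 2 : Fin 3) = 0 from rfl, add_zero] at h3
    -- With W = I_r V and s = r + 1, this pairing gives g(T(W, u), v) - g(T(W, I_s u), I_s v) =
    -- g(I_{r+2} u, I_s v), and the right side is -F_r(u, v). The factor -2 in the form absorbs this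
    -- sign and the 1/2 of the potential equation.
    have h4 := congrArg (inner ℝ · (J (r + 1) x v)) h2
    simp only [inner_sub_left, hJ.orthogonal] at h4
    have h5 := hJ.inner_left (r + 1) x (J (r + 2) x u) v
    rw [h3] at h5
    rw [h1, hD.extDeriv_actOne hJ hV, hD.extDeriv_actOne hJ hV, fundamentalForm]
    linarith

theorem IsHKTConnection.isParallelForm_dualForm (hD : IsHKTConnection J D)
    (hV : CMDiff ∞ (T% V)) (hDV : ∀ x, D V x = 0) (c : ℝ) :
    IsParallelForm D (fun x ↦ c • dualForm V x) := by
  intro x Y hY u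
  have hVx : MDiffAt (T% V) x := (hV x).mdifferentiableAt (by simp)
  have h : (fun y ↦ (c • dualForm V y) (Y y)) = (fun _ ↦ c) * fun y ↦ inner ℝ (V y) (Y y) := rfl
  have hd : MDifferentiableAt 𝓘(ℝ, E) 𝓘(ℝ, ℝ) (fun y ↦ (inner ℝ (V y) (Y y) : ℝ)) x :=
    mdiffAt_apply ((smoothForm_dualForm hV).diffFormAt x) hY
  rw [h, mvfderiv_mul mdifferentiableAt_const hd]
  simp [mvfderiv_const, hD.metric x V Y hVx hY, hDV, dualForm]

omit [FiniteDimensional ℝ E]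
  [IsContMDiffRiemannianBundle 𝓘(ℝ, E) ∞ E fun x : M ↦ TangentSpace 𝓘(ℝ, E) x] in
theorem IsPotentialOneForm.isPotentialFunctionOn {η : OneForm E M} (hη : IsPotentialOneForm J η)
    {U : Set M} (hU : IsOpen U) {μ : M → ℝ} (hμ : ContMDiffOn 𝓘(ℝ, E) 𝓘(ℝ, ℝ) ∞ μ U)
    (h : ∀ y ∈ U, mvfderiv 𝓘(ℝ, E) μ y = η y) : IsPotentialFunctionOn J U μ where
  isOpen := hU
  smooth := hμ
  eq r x hx u v := by
    have h1 : ∀ s, ∀ᶠ y in 𝓝 x, actOne (J s) η y = dFun (J s) μ y := fun s ↦ by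
      filter_upwards [hU.mem_nhds hx] with y hy
      simp only [dFun, actOne, h y hy]
    have h2 : ∀ᶠ y in 𝓝 x, actOne (J (r + 1)) (actOne (J (r + 2)) η) y
        = actOne (J (r + 1)) (dFun (J (r + 2)) μ) y :=
      (h1 (r + 2)).mono fun y hy ↦ congrArg (fun a ↦ -a.comp (J (r + 1) y)) hy
    rw [hη.eq r x u v, extDeriv_congr (h1 r)]
    simp only [dOne, Pi.neg_apply, actTwo, extDeriv_congr h2]

end Potential
end HKT

theorem mainTheorem2 {E : Type*} [NormedAddCommGroup E] [NormedSpace ℝ E] [FiniteDimensional ℝ E]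
    {M : Type*} [TopologicalSpace M] [ChartedSpace E M] [IsManifold 𝓘(ℝ, E) ∞ M]
    [RiemannianBundle (fun x : M ↦ TangentSpace 𝓘(ℝ, E) x)]
    [IsContMDiffRiemannianBundle 𝓘(ℝ, E) ∞ E (fun x : M ↦ TangentSpace 𝓘(ℝ, E) x)]
    (J : Fin 3 → HKT.EndField E M) (hJ : HKT.IsHyperhermitian J)
    (D : CovariantDerivative 𝓘(ℝ, E) E (TangentSpace 𝓘(ℝ, E) : M → Type _))
    (hD : HKT.IsHKTConnection J D)
    (V : HKT.VecField E M) (hV : HKT.IsD21Symmetry J V) :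
    HKT.IsPotentialOneForm J (fun x ↦ (-2 : ℝ) • HKT.dualForm V x) ∧
      HKT.IsParallelForm D (fun x ↦ (-2 : ℝ) • HKT.dualForm V x) ∧
      ∀ x : M, ∃ (U : Set M) (μ : M → ℝ), x ∈ U ∧ HKT.IsPotentialFunctionOn J U μ := by
  have hpot := hD.isPotentialOneForm hJ hV
  refine ⟨hpot, hD.isParallelForm_dualForm hV.smooth (hD.parallel_of_isD21Symmetry hJ hV) _,
    fun x ↦ ?_⟩
  -- Closedness of the dual form passes to its multiple by -2, so a local primitive exists.
  obtain ⟨U, μ, hx, hU, hμ, hdμ⟩ := HKT.exists_local_primitive hpot.smooth (fun y u v ↦ by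
    rw [HKT.extDeriv_const_smul ((HKT.smoothForm_dualForm hV.smooth).diffFormAt y), hV.closed,
      mul_zero]) x
  exact ⟨U, μ, hx, hpot.isPotentialFunctionOn hU hμ hdμ⟩
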